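/- Let $n\ge 0$ be an integer, let indices $i,j,k,p,q,s$ range over $1,\dots,n+1$, and let $$D=\mathbf{C}\langle x_{ij},y_k,r,\partial_{ij},\partial_k,\partial_r \mid 1\le i\le j\le n+1,\ 1\le k\le n+1\rangle$$ be the Weyl algebra, where $\partial_{ij}=\partial/\partial x_{ij}$, $\partial_k=\partial/\partial y_k$, $\partial_r=\partial/\partial r$, and $x_{ij}=x_{ji}$, $\partial_{ij}=\partial_{ji}$. For complex constants $a_{pq}=a_{qp}$, $b_i$, $c_i$, $d$, let $I'$ be the left ideal of $D$ generated by \begin{align*} A'_{pq}&=x_{pq}\partial_{pq}-x_{pq}\partial_p\partial_q-a_{pq}^3 \quad (p\le q),\\ B&=\sum_{i=1}^{n+1}\partial_i^2-r^2,\\ C'_{ij}&=x_{ij}\partial_i^2+2(x_{jj}-x_{ii})\partial_i\partial_j-x_{ij}\partial_j^2+\sum_{s\ne i,j}\left(x_{sj}\partial_i\partial_s-x_{is}\partial_j\partial_s\right)+(y_j+b_jc_j)\partial_i-(y_i+b_ic_i)\partial_j \quad (i<j),\\ E'&=r\partial_r-2\sum_{i\le j}x_{ij}\partial_i\partial_j-\sum_{i=1}^{n+1}(y_i+b_ic_i)\partial_i-n-d^3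 \end{align*} (the Fisher–Bingham system transformed by the gauge factor $r^{d^3}\prod_{p\le q}x_{pq}^{a_{pq}^3}$ and the shift $y_i\mapsto y_i+b_ic_i$), and let $\tilde I'$ be the left ideal of $D$ generated by \begin{align*} \tilde A'_{ii}&=x_{ii}\partial_{ii}-x_{ii}\partial_i^2-a_{ii}^3 \quad (1\le i\le n+1),\\ B&=\sum_{i=1}^{n+1}\partial_i^2-r^2,\\ \tilde C'_{ij}&=2(x_{jj}-x_{ii})\partial_i\partial_j+(y_j+b_jc_j)\partial_i-(y_i+b_ic_i)\partial_j \quad (i<j),\\ \tilde E'&=r\partial_r-2\sum_{i=1}^{n+1}x_{ii}\partial_i^2-\sum_{i=1}^{n+1}(y_i+b_ic_i)\partial_i-n-d^3,\\ &\phantom{=}\ \ x_{ij}\partial_{ij}-a_{ij}^3 \quad (i\ne j) \end{align*} (the diagonal system transformed in the same way). Let $w$ be the weight vector giving weight $1$ to $\partial_{ij}$ for $i\ne j$ and weight $0$ to $\partial_{ii}$, $\partial_k$, $\partial_r$; under $(-w,w)$ each space variable has minus the weight of its derivation. For $\ell\in D$, written in normally ordered form (variables to the left of derivations), $\mathrm{in}_{(-w,w)}(\ell)\in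 D$ is the sum of the terms of $\ell$ of highest $(-w,w)$-degree, and $\mathrm{in}_{(-w,w)}(I')$ is the left ideal of $D$ generated by the $\mathrm{in}_{(-w,w)}(\ell)$ with $\ell\in I'$. Then for generic $(a_{pq})_{p\le q},(b_i),(c_i),d$, that is, for all values of these constants outside the zero set of some nonzero polynomial in them (depending only on $n$), one has $$\mathrm{in}_{(-w,w)}(I')=\tilde I'.$$ -/

import Mathlib

/-- The defining relations of the Weyl algebra in the variables `x i`, `∂ i`, `i : σ`;
`Sum.inl i` is the letter `x i` and `Sum.inr i` is the letter `∂ i`. -/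
inductive WeylRel (R : Type*) [CommRing R] (σ : Type*) :
    FreeAlgebra R (σ ⊕ σ) → FreeAlgebra R (σ ⊕ σ) → Prop
  | xx (i j : σ) : WeylRel R σ
      (FreeAlgebra.ι R (Sum.inl i) * FreeAlgebra.ι R (Sum.inl j))
      (FreeAlgebra.ι R (Sum.inl j) * FreeAlgebra.ι R (Sum.inl i))
  | dd (i j : σ) : WeylRel R σ
      (FreeAlgebra.ι R (Sum.inr i) * FreeAlgebra.ι R (Sum.inr j))
      (FreeAlgebra.ι R (Sum.inr j) * FreeAlgebra.ι R (Sum.inr i))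
  | dx_ne (i j : σ) (h : i ≠ j) : WeylRel R σ
      (FreeAlgebra.ι R (Sum.inr i) * FreeAlgebra.ι R (Sum.inl j))
      (FreeAlgebra.ι R (Sum.inl j) * FreeAlgebra.ι R (Sum.inr i))
  | dx_self (i : σ) : WeylRel R σ
      (FreeAlgebra.ι R (Sum.inr i) * FreeAlgebra.ι R (Sum.inl i))
      (FreeAlgebra.ι R (Sum.inl i) * FreeAlgebra.ι R (Sum.inr i) + 1)

/-- The Weyl algebra `R⟨x i, ∂ i | i : σ⟩`. -/
abbrev WeylAlgebra (R : Type*) [CommRing R] (σ : Type*) : Type _ := RingQuot (WeylRel R σ)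

namespace WeylAlgebra

section Basic

variable (R : Type*) [CommRing R] {σ : Type*}

/-- The space variable `x i`. -/
noncomputable def x (i : σ) : WeylAlgebra R σ :=
  RingQuot.mkAlgHom R (WeylRel R σ) (FreeAlgebra.ι R (Sum.inl i))

/-- The derivation `∂ i = ∂/∂x i`. -/
noncomputable def d (i : σ) : WeylAlgebra R σ :=
  RingQuot.mkAlgHom R (WeylRel R σ) (FreeAlgebra.ι R (Sum.inr i))

theorem x_comm (i j : σ) : Commute (x R i) (x R j) := by
  have h := RingQuot.mkAlgHom_rel R (WeylRel.xx (R := R) i j)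
  rw [map_mul, map_mul] at h
  exact h

theorem d_comm (i j : σ) : Commute (d R i) (d R j) := by
  have h := RingQuot.mkAlgHom_rel R (WeylRel.dd (R := R) i j)
  rw [map_mul, map_mul] at h
  exact h

theorem d_mul_x_of_ne {i j : σ} (hij : i ≠ j) : d R i * x R j = x R j * d R i := by
  have h := RingQuot.mkAlgHom_rel R (WeylRel.dx_ne (R := R) i j hij)
  rw [map_mul, map_mul] at h
  exact h

theorem d_mul_x_self (i : σ) : d R i * x R i = x R i * d R i + 1 := by
  have h := RingQuot.mkAlgHom_rel R (WeylRel.dx_self (R := R) i)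
  rw [map_add, map_mul, map_mul, map_one] at h
  exact h

theorem exponent_induction {P : (σ →₀ ℕ) → Prop} (h0 : P 0)
    (hs : ∀ α i, P α → P (α + Finsupp.single i 1)) (α : σ →₀ ℕ) : P α := by
  classical
  refine Finsupp.induction₂ α h0 fun i k f _ hk hf => ?_
  clear hk
  induction k with
  | zero => simpa using hf
  | succ k ih => rw [Finsupp.single_add, ← add_assoc]; exact hs _ _ ih

theorem pairwise_commute_pow {A : Type*} [Monoid A] {f : σ → A}
    (hf : ∀ i j, Commute (f i) (f j)) (α : σ →₀ ℕ) (s : Finset σ) :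
    (s : Set σ).Pairwise (Function.onFun Commute (fun i => f i ^ α i)) :=
  fun i _ j _ _ => (hf i j).pow_pow (α i) (α j)

variable [Fintype σ]

/-- The monomial `x ^ α = ∏ i, x i ^ α i` (the factors commute). -/
noncomputable def xMon (α : σ →₀ ℕ) : WeylAlgebra R σ :=
  Finset.univ.noncommProd (fun i => x R i ^ α i) (pairwise_commute_pow (x_comm R) α _)

/-- The monomial `∂ ^ β = ∏ i, ∂ i ^ β i` (the factors commute). -/
noncomputable def dMon (β : σ →₀ ℕ) : WeylAlgebra R σ :=
  Finset.univ.noncommProd (fun i => d R i ^ β i) (pairwise_commute_pow (d_comm R) β _)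

theorem noncommProd_single {A : Type*} [Monoid A] (f : σ → A)
    (hf : ∀ i j, Commute (f i) (f j)) (i : σ) (k : ℕ) :
    Finset.univ.noncommProd (fun j => f j ^ (Finsupp.single i k : σ →₀ ℕ) j)
      (pairwise_commute_pow hf _ _) = f i ^ k := by
  classical
  have h : (Finset.univ : Finset σ) = insert i (Finset.univ.erase i) := by simp
  have e : Finset.univ.noncommProd (fun j => f j ^ (Finsupp.single i k : σ →₀ ℕ) j)
      (pairwise_commute_pow hf _ _) =
      (insert i (Finset.univ.erase i)).noncommProd
        (fun j => f j ^ (Finsupp.single i k : σ →₀ ℕ) j) (pairwise_commute_pow hf _ _) :=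
    Finset.noncommProd_congr h (fun _ _ => rfl) _
  rw [e, Finset.noncommProd_insert_of_notMem _ _ _ _ (Finset.notMem_erase _ _),
    Finset.noncommProd_eq_pow_card _ _ _ 1]
  · simp
  · intro j hj
    rw [Finsupp.single_eq_of_ne (Finset.ne_of_mem_erase hj), pow_zero]

theorem noncommProd_add {A : Type*} [Monoid A] (f : σ → A)
    (hf : ∀ i j, Commute (f i) (f j)) (α β : σ →₀ ℕ) :
    Finset.univ.noncommProd (fun j => f j ^ (α + β) j) (pairwise_commute_pow hf _ _) =
    Finset.univ.noncommProd (fun j => f j ^ α j) (pairwise_commute_pow hf _ _) *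
    Finset.univ.noncommProd (fun j => f j ^ β j) (pairwise_commute_pow hf _ _) := by
  rw [← Finset.noncommProd_mul_distrib]
  · exact Finset.noncommProd_congr rfl (fun j _ => by simp [pow_add]) _
  · exact fun a _ b _ _ => (hf a b).pow_pow (β a) (α b)

theorem xMon_add (α β : σ →₀ ℕ) : xMon R (α + β) = xMon R α * xMon R β :=
  noncommProd_add _ (x_comm R) α β

theorem dMon_add (α β : σ →₀ ℕ) : dMon R (α + β) = dMon R α * dMon R β :=
  noncommProd_add _ (d_comm R) α β

theorem xMon_single (i : σ) (k : ℕ) : xMon R (Finsupp.single i k) = x R i ^ k :=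
  noncommProd_single _ (x_comm R) i k

theorem dMon_single (i : σ) (k : ℕ) : dMon R (Finsupp.single i k) = d R i ^ k :=
  noncommProd_single _ (d_comm R) i k

@[simp] theorem xMon_zero : xMon R (0 : σ →₀ ℕ) = 1 := by
  unfold xMon
  rw [Finset.noncommProd_eq_pow_card _ _ _ 1 (by simp)]
  simp

@[simp] theorem dMon_zero : dMon R (0 : σ →₀ ℕ) = 1 := by
  unfold dMon
  rw [Finset.noncommProd_eq_pow_card _ _ _ 1 (by simp)]
  simp

/-- `∂ i x ^ α = x ^ α ∂ i + α i x ^ (α - e i)`. -/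
theorem d_mul_xMon (i : σ) (α : σ →₀ ℕ) :
    d R i * xMon R α = xMon R α * d R i + α i • xMon R (α - Finsupp.single i 1) := by
  classical
  induction α using exponent_induction with
  | h0 => simp
  | hs α j ih =>
    have hx : xMon R (α + Finsupp.single j 1) = x R j * xMon R α := by
      rw [add_comm, xMon_add, xMon_single, pow_one]
    by_cases hij : i = j
    · subst hij
      have h2 : α i • (x R i * xMon R (α - Finsupp.single i 1)) = α i • xMon R α := by
        by_cases h : α i = 0
        · simp [h]
        · rw [← pow_one (x R i), ← xMon_single, ← xMon_add]
          congr 2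
          ext k
          by_cases hk : k = i
          · subst hk; simp; omega
          · simp [Finsupp.single_eq_of_ne hk]
      rw [hx, ← mul_assoc, d_mul_x_self, add_mul, mul_assoc, ih, mul_add, mul_smul_comm, h2]
      simp [add_smul, mul_assoc, add_assoc]
    · have h2 : x R j * xMon R (α - Finsupp.single i 1)
          = xMon R (α + Finsupp.single j 1 - Finsupp.single i 1) := by
        rw [← pow_one (x R j), ← xMon_single, ← xMon_add]
        congr 1
        ext k
        by_cases hk : k = i
        · subst hk; simp [Finsupp.single_eq_of_ne hij]
        · simp [Finsupp.single_eq_of_ne hk, add_comm]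
      rw [hx, ← mul_assoc, d_mul_x_of_ne R hij, mul_assoc, ih, mul_add, mul_smul_comm, h2]
      simp [mul_assoc, Finsupp.single_eq_of_ne hij]

/-- The linear map that sends a finitely supported family of coefficients `c (α, β)` to the
normally ordered operator `∑ c (α, β) x ^ α ∂ ^ β`. -/
noncomputable def ofCoeff : (((σ →₀ ℕ) × (σ →₀ ℕ)) →₀ R) →ₗ[R] WeylAlgebra R σ :=
  Finsupp.linearCombination R (fun m => xMon R m.1 * dMon R m.2)

theorem ofCoeff_single (m : (σ →₀ ℕ) × (σ →₀ ℕ)) (c : R) :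
    ofCoeff R (Finsupp.single m c) = c • (xMon R m.1 * dMon R m.2) := by
  simp [ofCoeff]

theorem mon_mem_range (α β : σ →₀ ℕ) :
    xMon R α * dMon R β ∈ LinearMap.range (ofCoeff R (σ := σ)) :=
  ⟨Finsupp.single (α, β) 1, by simp [ofCoeff_single]⟩

theorem x_mul_mem_range (i : σ) {p : WeylAlgebra R σ}
    (hp : p ∈ LinearMap.range (ofCoeff R (σ := σ))) :
    x R i * p ∈ LinearMap.range (ofCoeff R (σ := σ)) := by
  obtain ⟨f, rfl⟩ := hp
  induction f using Finsupp.induction_linear with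
  | zero => simp
  | add f g hf hg => rw [map_add, mul_add]; exact add_mem hf hg
  | single m c =>
    rw [ofCoeff_single, mul_smul_comm, ← mul_assoc, ← pow_one (x R i), ← xMon_single, ← xMon_add]
    exact Submodule.smul_mem _ _ (mon_mem_range R _ _)

theorem d_mul_mem_range (i : σ) {p : WeylAlgebra R σ}
    (hp : p ∈ LinearMap.range (ofCoeff R (σ := σ))) :
    d R i * p ∈ LinearMap.range (ofCoeff R (σ := σ)) := by
  obtain ⟨f, rfl⟩ := hp
  induction f using Finsupp.induction_linear with
  | zero => simp
  | add f g hf hg => rw [map_add, mul_add]; exact add_mem hf hg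
  | single m c =>
    rw [ofCoeff_single, mul_smul_comm, ← mul_assoc, d_mul_xMon, add_mul, mul_assoc,
      smul_mul_assoc, ← pow_one (d R i), ← dMon_single, ← dMon_add]
    exact Submodule.smul_mem _ _ (add_mem (mon_mem_range R _ _)
      (nsmul_mem (mon_mem_range R _ _) _))

/-- Every operator can be written in normally ordered form. -/
theorem ofCoeff_surjective : Function.Surjective (ofCoeff R (σ := σ)) := by
  intro p
  obtain ⟨q, rfl⟩ := RingQuot.mkAlgHom_surjective R (WeylRel R σ) p
  suffices h : ∀ u : WeylAlgebra R σ, u ∈ LinearMap.range (ofCoeff R (σ := σ)) →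
      RingQuot.mkAlgHom R (WeylRel R σ) q * u ∈ LinearMap.range (ofCoeff R (σ := σ)) by
    have h1 := h 1 (by simpa using mon_mem_range R (0 : σ →₀ ℕ) 0)
    rwa [mul_one] at h1
  induction q using FreeAlgebra.induction with
  | grade0 r =>
    intro u hu
    rw [AlgHom.commutes, ← Algebra.smul_def]
    exact Submodule.smul_mem _ _ hu
  | grade1 s =>
    intro u hu
    cases s with
    | inl i => exact x_mul_mem_range R i hu
    | inr i => exact d_mul_mem_range R i hu
  | mul a b ha hb =>
    intro u hu
    rw [map_mul, mul_assoc]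
    exact ha _ (hb _ hu)
  | add a b ha hb =>
    intro u hu
    rw [map_add, add_mul]
    exact add_mem (ha _ hu) (hb _ hu)

end Basic

section Action

variable (R : Type*) [CommRing R] {σ : Type*}

/-- The letters acting on polynomials: multiplication by `X i`, and partial derivatives. -/
noncomputable def letterAction : σ ⊕ σ → Module.End R (MvPolynomial σ R)
  | Sum.inl i => LinearMap.mulLeft R (MvPolynomial.X i)
  | Sum.inr i => (MvPolynomial.pderiv i).toLinearMap

theorem pderiv_comm (i j : σ) (f : MvPolynomial σ R) :
    MvPolynomial.pderiv i (MvPolynomial.pderiv j f)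
      = MvPolynomial.pderiv j (MvPolynomial.pderiv i f) := by
  classical
  induction f using MvPolynomial.induction_on with
  | C a => simp
  | add p q hp hq => simp [hp, hq]
  | mul_X p k hp =>
    have hz : ∀ a b, MvPolynomial.pderiv a
        ((Pi.single k 1 : σ → MvPolynomial σ R) b) = 0 := by
      intro a b
      by_cases hb : b = k
      · subst hb; simp
      · simp [hb]
    have hX : ∀ b, MvPolynomial.pderiv b (MvPolynomial.X k : MvPolynomial σ R)
        = (Pi.single k 1 : σ → MvPolynomial σ R) b := by
      intro b
      rw [MvPolynomial.pderiv_X, Pi.single_comm]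
    simp only [Derivation.leibniz, map_add, smul_eq_mul, hX, hp, hz]
    ring

/-- The action of the Weyl algebra on polynomials as differential operators. -/
noncomputable def action : WeylAlgebra R σ →ₐ[R] Module.End R (MvPolynomial σ R) :=
  RingQuot.liftAlgHom R ⟨FreeAlgebra.lift R (letterAction R), by
    intro p q h
    cases h with
    | xx i j =>
      refine LinearMap.ext fun f => ?_
      simp [letterAction, mul_left_comm]
    | dd i j =>
      refine LinearMap.ext fun f => ?_
      simp [letterAction, pderiv_comm R i j]
    | dx_ne i j h =>
      refine LinearMap.ext fun f => ?_
      simp [letterAction, MvPolynomial.pderiv_X_of_ne h.symm]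
    | dx_self i =>
      refine LinearMap.ext fun f => ?_
      simp [letterAction]⟩

@[simp] theorem action_x (i : σ) (f : MvPolynomial σ R) :
    action R (x R i) f = MvPolynomial.X i * f := by
  simp [action, x, letterAction]

@[simp] theorem action_d (i : σ) (f : MvPolynomial σ R) :
    action R (d R i) f = MvPolynomial.pderiv i f := by
  simp [action, d, letterAction]

variable [Fintype σ]

theorem action_xMon (α : σ →₀ ℕ) (f : MvPolynomial σ R) :
    action R (xMon R α) f = MvPolynomial.monomial α 1 * f := by
  induction α using exponent_induction with
  | h0 => simp
  | hs α i ih =>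
    rw [add_comm, xMon_add, xMon_single, pow_one, map_mul, Module.End.mul_apply, ih, action_x,
      ← mul_assoc, MvPolynomial.X, MvPolynomial.monomial_mul, one_mul]

theorem action_dMon (β γ : σ →₀ ℕ) (c : R) :
    action R (dMon R β) (MvPolynomial.monomial γ c)
      = MvPolynomial.monomial (γ - β) (c * ∏ i, ((γ i).descFactorial (β i) : R)) := by
  classical
  induction β using exponent_induction with
  | h0 => simp
  | hs β i ih =>
    rw [add_comm, dMon_add, dMon_single, pow_one, map_mul, Module.End.mul_apply, ih, action_d,
      MvPolynomial.pderiv_monomial, tsub_tsub, add_comm β, mul_assoc]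
    congr 2
    rw [← Finset.mul_prod_erase _ _ (Finset.mem_univ i),
      ← Finset.mul_prod_erase _ _ (Finset.mem_univ i)]
    have h : ∏ j ∈ Finset.univ.erase i, ((γ j).descFactorial ((Finsupp.single i 1 + β : σ →₀ ℕ) j) : R)
        = ∏ j ∈ Finset.univ.erase i, ((γ j).descFactorial (β j) : R) := by
      refine Finset.prod_congr rfl fun j hj => ?_
      simp [Finsupp.single_eq_of_ne (Finset.ne_of_mem_erase hj)]
    rw [h]
    simp only [Finsupp.coe_add, Pi.add_apply, Finsupp.single_eq_same, Finsupp.coe_tsub,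
      Pi.sub_apply]
    rw [add_comm 1, Nat.descFactorial_succ]
    push_cast
    ring

/-- The normally ordered form of an operator is unique. -/
theorem ofCoeff_injective [IsDomain R] [CharZero R] :
    Function.Injective (ofCoeff R (σ := σ)) := by
  classical
  rw [injective_iff_map_eq_zero]
  intro f hf
  by_contra hne
  obtain ⟨m₀, hm₀⟩ := Finsupp.support_nonempty_iff.mpr hne
  obtain ⟨β, hβ, hmin⟩ := (f.support.image Prod.snd).exists_minimal
    ⟨m₀.2, Finset.mem_image_of_mem _ hm₀⟩
  obtain ⟨⟨α, β'⟩, hα, rfl⟩ := Finset.mem_image.mp hβ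
  have hterm : ∀ m ∈ f.support,
      action R (f m • (xMon R m.1 * dMon R m.2)) (MvPolynomial.monomial β' 1)
        = MvPolynomial.monomial m.1
          (if m.2 = β' then f m * ∏ i, ((β' i).factorial : R) else 0) := by
    intro m hm
    rw [map_smul, LinearMap.smul_apply, map_mul, Module.End.mul_apply, action_dMon, action_xMon,
      MvPolynomial.monomial_mul, MvPolynomial.smul_monomial]
    by_cases h : m.2 = β'
    · simp [h, Nat.descFactorial_self]
    · rw [if_neg h]
      have hlt : ∃ i, β' i < m.2 i := by
        by_contra hcon
        push Not at hcon
        have hle : m.2 ≤ β' := fun i => hcon i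
        exact h (le_antisymm hle (hmin (Finset.mem_image_of_mem _ hm) hle))
      obtain ⟨i, hi⟩ := hlt
      have hz : ∏ i, ((β' i).descFactorial (m.2 i) : R) = 0 :=
        Finset.prod_eq_zero (Finset.mem_univ i)
          (by rw [Nat.descFactorial_eq_zero_iff_lt.mpr hi, Nat.cast_zero])
      simp [hz]
  have h0 : ∑ m ∈ f.support, MvPolynomial.monomial m.1
      (if m.2 = β' then f m * ∏ i, ((β' i).factorial : R) else 0)
        = (0 : MvPolynomial σ R) := by
    rw [← Finset.sum_congr rfl hterm, ← LinearMap.sum_apply, ← map_sum]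
    have : ∑ m ∈ f.support, f m • (xMon R m.1 * dMon R m.2) = ofCoeff R f := by
      simp [ofCoeff, Finsupp.linearCombination_apply, Finsupp.sum]
    rw [this, hf, map_zero, LinearMap.zero_apply]
  have h1 := congrArg (MvPolynomial.coeff α) h0
  rw [MvPolynomial.coeff_sum, Finset.sum_eq_single (α, β')] at h1
  · simp only [if_true, MvPolynomial.coeff_monomial, MvPolynomial.coeff_zero, mul_eq_zero] at h1
    rcases h1 with h1 | h1
    · exact Finsupp.mem_support_iff.mp hα h1
    · obtain ⟨i, _, hi⟩ := Finset.prod_eq_zero_iff.mp h1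
      exact Nat.factorial_ne_zero _ (Nat.cast_eq_zero.mp hi)
  · rintro ⟨α', β''⟩ _ hne'
    rw [MvPolynomial.coeff_monomial]
    by_cases h : α' = α
    · subst h
      have : β'' ≠ β' := fun h => hne' (by rw [h])
      simp [this]
    · simp [h]
  · intro h
    exact absurd hα h

end Action

section InitialForm

variable {R : Type*} [CommRing R] [IsDomain R] [CharZero R] {σ : Type*} [Fintype σ]

/-- The Weyl algebra has the monomials `x ^ α ∂ ^ β` as a basis; the coefficient of `x ^ α ∂ ^ β`
in the operator `p` is `coeffs p (α, β)`. -/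
noncomputable def coeffs :
    WeylAlgebra R σ ≃ₗ[R] (((σ →₀ ℕ) × (σ →₀ ℕ)) →₀ R) :=
  (LinearEquiv.ofBijective (ofCoeff R (σ := σ))
    ⟨ofCoeff_injective R, ofCoeff_surjective R⟩).symm

/-- The `(-w, w)`-degree `∑ i, w i (β i - α i)` of the monomial `x ^ α ∂ ^ β`. -/
def wDegree (w : σ → ℤ) (m : (σ →₀ ℕ) × (σ →₀ ℕ)) : ℤ :=
  ∑ i, w i * ((m.2 i : ℤ) - (m.1 i : ℤ))

open Classical in
/-- The initial form `in_(-w,w)(p)`: the sum of the terms `c x ^ α ∂ ^ β` of highest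
`(-w, w)`-degree in `p`. -/
noncomputable def initialForm (w : σ → ℤ) (p : WeylAlgebra R σ) : WeylAlgebra R σ :=
  coeffs.symm ((coeffs p).filter
    (fun m => ∀ m' ∈ (coeffs p).support, wDegree w m' ≤ wDegree w m))

/-- The initial ideal `in_(-w,w)(J)`: the left ideal generated by the initial forms of the
elements of the left ideal `J`. -/
noncomputable def initialIdeal (w : σ → ℤ) (J : Ideal (WeylAlgebra R σ)) :
    Ideal (WeylAlgebra R σ) :=
  Ideal.span (initialForm w '' (J : Set (WeylAlgebra R σ)))

end InitialForm

end WeylAlgebra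

/-- Indices of the variables `x_ij = x_ji`, `y_k`, `r` with `1 ≤ i, j, k ≤ n + 1`. -/
abbrev FBVar (n : ℕ) : Type := Sym2 (Fin (n + 1)) ⊕ Fin (n + 1) ⊕ Unit

/-- Indices of the constants `a_pq = a_qp`, `b_i`, `c_i`, `d`. -/
inductive FBConst (n : ℕ) : Type
  | a (pq : Sym2 (Fin (n + 1)))
  | b (i : Fin (n + 1))
  | c (i : Fin (n + 1))
  | d

namespace FisherBingham

variable {n : ℕ}

/-- The Weyl algebra `D = ℂ⟨x_ij, y_k, r, ∂_ij, ∂_k, ∂_r⟩`. -/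
abbrev D (n : ℕ) : Type := WeylAlgebra ℂ (FBVar n)

/-- The variable `x_ij`. -/
noncomputable def x (i j : Fin (n + 1)) : D n := WeylAlgebra.x ℂ (Sum.inl s(i, j))

/-- The variable `y_k`. -/
noncomputable def y (k : Fin (n + 1)) : D n := WeylAlgebra.x ℂ (Sum.inr (Sum.inl k))

/-- The variable `r`. -/
noncomputable def r : D n := WeylAlgebra.x ℂ (Sum.inr (Sum.inr ()))

/-- `∂_ij = ∂/∂x_ij`. -/
noncomputable def dx (i j : Fin (n + 1)) : D n := WeylAlgebra.d ℂ (Sum.inl s(i, j))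

/-- `∂_k = ∂/∂y_k`. -/
noncomputable def dy (k : Fin (n + 1)) : D n := WeylAlgebra.d ℂ (Sum.inr (Sum.inl k))

/-- `∂_r = ∂/∂r`. -/
noncomputable def dr : D n := WeylAlgebra.d ℂ (Sum.inr (Sum.inr ()))

/-- A complex constant as an element of `D`. -/
noncomputable def const (z : ℂ) : D n := algebraMap ℂ (D n) z

/-- The weight vector: `1` for `∂_ij` with `i ≠ j`, and `0` for all the other derivations. -/
def weight : FBVar n → ℤ
  | Sum.inl p => if p.IsDiag then 0 else 1
  | Sum.inr _ => 0

variable (θ : FBConst n → ℂ)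

/-- The shifted variable `y_i + b_i c_i`. -/
noncomputable def yShift (i : Fin (n + 1)) : D n := y i + const (θ (.b i) * θ (.c i))

/-- `A'_pq = x_pq ∂_pq - x_pq ∂_p ∂_q - a_pq ^ 3`. -/
noncomputable def opA (p q : Fin (n + 1)) : D n :=
  x p q * dx p q - x p q * dy p * dy q - const (θ (.a s(p, q)) ^ 3)

/-- `B = ∑ i, ∂_i ^ 2 - r ^ 2`. -/
noncomputable def opB : D n := ∑ i, dy i ^ 2 - r ^ 2

/-- `C'_ij = x_ij ∂_i ^ 2 + 2 (x_jj - x_ii) ∂_i ∂_j - x_ij ∂_j ^ 2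
+ ∑ s ≠ i, j, (x_sj ∂_i ∂_s - x_is ∂_j ∂_s) + (y_j + b_j c_j) ∂_i - (y_i + b_i c_i) ∂_j`. -/
noncomputable def opC (i j : Fin (n + 1)) : D n :=
  x i j * dy i ^ 2 + 2 * (x j j - x i i) * dy i * dy j - x i j * dy j ^ 2
    + ∑ s with s ≠ i ∧ s ≠ j, (x s j * dy i * dy s - x i s * dy j * dy s)
    + yShift θ j * dy i - yShift θ i * dy j

/-- `E' = r ∂_r - 2 ∑ i ≤ j, x_ij ∂_i ∂_j - ∑ i, (y_i + b_i c_i) ∂_i - n - d ^ 3`. -/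
noncomputable def opE : D n :=
  r * dr - 2 * ∑ i, ∑ j with i ≤ j, x i j * dy i * dy j - ∑ i, yShift θ i * dy i
    - const (n : ℂ) - const (θ .d ^ 3)

/-- The transformed Fisher–Bingham system `I'`, the left ideal generated by the
`A'_pq` (`p ≤ q`), `B`, `C'_ij` (`i < j`) and `E'`. -/
noncomputable def transformedSystem : Ideal (D n) :=
  Ideal.span ({P | ∃ p q, p ≤ q ∧ P = opA θ p q} ∪ {opB}
    ∪ {P | ∃ i j, i < j ∧ P = opC θ i j} ∪ {opE θ})

/-- `x_ii ∂_ii - x_ii ∂_i ^ 2 - a_ii ^ 3`. -/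
noncomputable def diagA (i : Fin (n + 1)) : D n :=
  x i i * dx i i - x i i * dy i ^ 2 - const (θ (.a s(i, i)) ^ 3)

/-- `x_ij ∂_ij - a_ij ^ 3`, used for `i ≠ j`. -/
noncomputable def diagOff (i j : Fin (n + 1)) : D n :=
  x i j * dx i j - const (θ (.a s(i, j)) ^ 3)

/-- `2 (x_jj - x_ii) ∂_i ∂_j + (y_j + b_j c_j) ∂_i - (y_i + b_i c_i) ∂_j`. -/
noncomputable def diagC (i j : Fin (n + 1)) : D n :=
  2 * (x j j - x i i) * dy i * dy j + yShift θ j * dy i - yShift θ i * dy j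

/-- `r ∂_r - 2 ∑ i, x_ii ∂_i ^ 2 - ∑ i, (y_i + b_i c_i) ∂_i - n - d ^ 3`. -/
noncomputable def diagE : D n :=
  r * dr - 2 * ∑ i, x i i * dy i ^ 2 - ∑ i, yShift θ i * dy i
    - const (n : ℂ) - const (θ .d ^ 3)

/-- The transformed diagonal system, the left ideal generated by the
`x_ii ∂_ii - x_ii ∂_i ^ 2 - a_ii ^ 3`, `B`, the diagonal `C'_ij` (`i < j`), the diagonal `E'` and
the `x_ij ∂_ij - a_ij ^ 3` (`i ≠ j`). -/
noncomputable def transformedDiagonalSystem : Ideal (D n) :=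
  Ideal.span ({P | ∃ i, P = diagA θ i} ∪ {opB}
    ∪ {P | ∃ i j, i < j ∧ P = diagC θ i j} ∪ {diagE θ}
    ∪ {P | ∃ i j, i ≠ j ∧ P = diagOff θ i j})

end FisherBingham

/-!
The initial ideal equals the diagonal system for every choice of the constants: the two systems
differ by an automorphism of `D` that is the identity up to terms of lower degree.

Let `G = ∑ i < j, x_ij ∂_i ∂_j`. As `x_ij`, `∂_i`, `∂_j` commute with one another, `ad G` is
nilpotent on the letters, and `φ = exp (ad G)` is the automorphism that maps `y_k` to
`y_k + ∑ s ≠ k, x_ks ∂_s` and `∂_ij` to `∂_ij - ∂_i ∂_j` for `i ≠ j`, and fixes the other letters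
(`FisherBingham.shear 1`). It maps each generator of the diagonal system to a generator of the
Fisher–Bingham system: the off-diagonal terms of `C'_ij` and `E'` are those created by the shift of
the `y_k`, and those of `A'_pq` by the shift of `∂_pq` (`FisherBingham.transformedSystem_eq_map`).

The operator `G` is homogeneous of `(-w, w)`-degree `-1`, so `φ p - p` has lower degree than `p`, and
the initial form of `φ p` is the top homogeneous component of `p`. The generators of the diagonal
system are homogeneous of degree `0`, so it contains the homogeneous components of its elements, in
particular this one; conversely a generator is the initial form of its own image
(`WeylAlgebra.initialIdeal_map_span`).
-/

/-! ### Operators of given degree -/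

open scoped Pointwise

namespace WeylAlgebra

section Weight

variable {R : Type*} [CommRing R] {σ : Type*} [Fintype σ]

/-- The operators all of whose monomials have `(-w, w)`-degree in `S`. The homogeneous operators of
degree `k` are `withDegree w {k}`, those of degree at most `k` are `withDegree w (Set.Iic k)`. -/
noncomputable def withDegree (w : σ → ℤ) (S : Set ℤ) : Submodule R (WeylAlgebra R σ) :=
  Submodule.span R ((fun m => xMon R m.1 * dMon R m.2) '' (wDegree w ⁻¹' S))

variable {w : σ → ℤ} {S T : Set ℤ}

theorem mon_mem_withDegree {α β : σ →₀ ℕ} (h : wDegree w (α, β) ∈ S) :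
    xMon R α * dMon R β ∈ withDegree (R := R) w S :=
  Submodule.subset_span ⟨(α, β), h, rfl⟩

theorem withDegree_mono (h : S ⊆ T) : withDegree (R := R) w S ≤ withDegree w T :=
  Submodule.span_mono (Set.image_mono (Set.preimage_mono h))

theorem withDegree_univ : withDegree (R := R) w Set.univ = ⊤ := by
  rw [eq_top_iff]
  rintro p -
  obtain ⟨f, rfl⟩ := ofCoeff_surjective R p
  induction f using Finsupp.induction_linear with
  | zero => simp
  | add f g hf hg => rw [map_add]; exact add_mem hf hg
  | single m c =>
    rw [ofCoeff_single]
    exact Submodule.smul_mem _ _ (mon_mem_withDegree (Set.mem_univ _))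

theorem wDegree_add (m m' : (σ →₀ ℕ) × (σ →₀ ℕ)) :
    wDegree w (m + m') = wDegree w m + wDegree w m' := by
  simp only [wDegree, ← Finset.sum_add_distrib]
  refine Finset.sum_congr rfl fun i _ => ?_
  simp only [Prod.fst_add, Prod.snd_add, Finsupp.coe_add, Pi.add_apply]
  push_cast
  ring

theorem wDegree_single_left (i : σ) : wDegree w (Finsupp.single i 1, 0) = -w i := by
  classical
  simp [wDegree, Finsupp.single_apply]

theorem wDegree_single_right (i : σ) : wDegree w (0, Finsupp.single i 1) = w i := by
  classical
  simp [wDegree, Finsupp.single_apply]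

theorem one_mem_withDegree : (1 : WeylAlgebra R σ) ∈ withDegree w {0} := by
  simpa using mon_mem_withDegree (R := R) (w := w) (S := {0}) (α := 0) (β := 0) (by simp [wDegree])

theorem algebraMap_mem_withDegree (c : R) :
    algebraMap R (WeylAlgebra R σ) c ∈ withDegree w {0} := by
  rw [Algebra.algebraMap_eq_smul_one]
  exact Submodule.smul_mem _ _ one_mem_withDegree

theorem x_mem_withDegree (i : σ) : x R i ∈ withDegree w {-w i} := by
  simpa [xMon_single] using mon_mem_withDegree (R := R) (w := w) (S := {-w i})
    (α := Finsupp.single i 1) (β := 0) (wDegree_single_left i)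

theorem d_mem_withDegree (i : σ) : d R i ∈ withDegree w {w i} := by
  simpa [dMon_single] using mon_mem_withDegree (R := R) (w := w) (S := {w i})
    (α := 0) (β := Finsupp.single i 1) (wDegree_single_right i)

theorem x_mul_mem_withDegree (i : σ) {k : ℤ} {p : WeylAlgebra R σ} (hp : p ∈ withDegree w {k}) :
    x R i * p ∈ withDegree w {-w i + k} := by
  induction hp using Submodule.span_induction with
  | zero => simp
  | add p q _ _ hp hq => rw [mul_add]; exact add_mem hp hq
  | smul c p _ hp => rw [mul_smul_comm]; exact Submodule.smul_mem _ _ hp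
  | mem p hp =>
    obtain ⟨⟨α, β⟩, h, rfl⟩ := hp
    rw [← mul_assoc, ← pow_one (x R i), ← xMon_single, ← xMon_add]
    refine mon_mem_withDegree ?_
    have := wDegree_add (w := w) (Finsupp.single i 1, 0) (α, β)
    rw [wDegree_single_left, h] at this
    simpa using this

theorem d_mul_mem_withDegree (i : σ) {k : ℤ} {p : WeylAlgebra R σ} (hp : p ∈ withDegree w {k}) :
    d R i * p ∈ withDegree w {w i + k} := by
  induction hp using Submodule.span_induction with
  | zero => simp
  | add p q _ _ hp hq => rw [mul_add]; exact add_mem hp hq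
  | smul c p _ hp => rw [mul_smul_comm]; exact Submodule.smul_mem _ _ hp
  | mem p hp =>
    obtain ⟨⟨α, β⟩, h, rfl⟩ := hp
    simp only [Set.mem_preimage, Set.mem_singleton_iff] at h
    rw [← mul_assoc, d_mul_xMon, add_mul, mul_assoc, smul_mul_assoc, ← pow_one (d R i),
      ← dMon_single, ← dMon_add]
    refine add_mem (mon_mem_withDegree ?_) ?_
    · have := wDegree_add (w := w) (0, Finsupp.single i 1) (α, β)
      rw [wDegree_single_right, h] at this
      simpa using this
    · by_cases hα : α i = 0
      · simp [hα]
      · refine nsmul_mem (mon_mem_withDegree ?_) _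
        have := wDegree_add (w := w) (Finsupp.single i 1, 0) (α - Finsupp.single i 1, β)
        have e : Finsupp.single i 1 + (α - Finsupp.single i 1) = α :=
          add_tsub_cancel_of_le (by simpa using Nat.one_le_iff_ne_zero.mpr hα)
        simp only [Prod.mk_add_mk, e, zero_add, h, wDegree_single_left] at this
        simp only [Set.mem_singleton_iff]
        omega

theorem mon_mul_mem_withDegree (m : (σ →₀ ℕ) × (σ →₀ ℕ)) {k : ℤ} {p : WeylAlgebra R σ}
    (hp : p ∈ withDegree w {k}) :
    xMon R m.1 * dMon R m.2 * p ∈ withDegree w {wDegree w m + k} := by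
  obtain ⟨α, β⟩ := m
  have hβ : dMon R β * p ∈ withDegree w {wDegree w (0, β) + k} := by
    induction β using exponent_induction with
    | h0 => simpa [wDegree] using hp
    | hs β i ih =>
      rw [add_comm β, dMon_add, dMon_single, pow_one, mul_assoc]
      have := wDegree_add (w := w) (0, Finsupp.single i 1) (0, β)
      simp only [Prod.mk_add_mk, zero_add, wDegree_single_right] at this
      rw [this, add_assoc]
      exact d_mul_mem_withDegree i ih
  induction α using exponent_induction with
  | h0 => simpa using hβ
  | hs α i ih =>
    simp only at ih ⊢
    rw [add_comm α, xMon_add, xMon_single, pow_one, mul_assoc, mul_assoc, ← mul_assoc (xMon R α)]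
    have := wDegree_add (w := w) (Finsupp.single i 1, 0) (α, β)
    simp only [Prod.mk_add_mk, zero_add, wDegree_single_left] at this
    rw [this, add_assoc]
    exact x_mul_mem_withDegree i ih

/-- The `(-w, w)`-degree is additive in products, because `∂ i x i - x i ∂ i = 1` is homogeneous of
degree `0`. -/
theorem mul_mem_withDegree {p q : WeylAlgebra R σ} (hp : p ∈ withDegree w S)
    (hq : q ∈ withDegree w T) : p * q ∈ withDegree w (S + T) := by
  suffices h : withDegree (R := R) w S * withDegree w T ≤ withDegree w (S + T) from
    h (Submodule.mul_mem_mul hp hq)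
  unfold withDegree
  rw [Submodule.span_mul_span, Submodule.span_le]
  rintro _ ⟨_, ⟨m, hm, rfl⟩, _, ⟨m', hm', rfl⟩, rfl⟩
  refine withDegree_mono ?_ (mon_mul_mem_withDegree m (mon_mem_withDegree rfl))
  rw [Set.singleton_subset_iff]
  exact Set.add_mem_add hm hm'

theorem mul_mem_withDegree_singleton {i j k : ℤ} {p q : WeylAlgebra R σ}
    (hp : p ∈ withDegree w {i}) (hq : q ∈ withDegree w {j}) (h : i + j = k) :
    p * q ∈ withDegree w {k} := by
  have := mul_mem_withDegree hp hq
  rwa [Set.singleton_add_singleton, h] at this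

theorem mul_mem_withDegree_Iic {i j k : ℤ} {p q : WeylAlgebra R σ}
    (hp : p ∈ withDegree w (Set.Iic i)) (hq : q ∈ withDegree w (Set.Iic j)) (h : i + j ≤ k) :
    p * q ∈ withDegree w (Set.Iic k) := by
  refine withDegree_mono ?_ (mul_mem_withDegree hp hq)
  rintro _ ⟨a, ha, b, hb, rfl⟩
  exact (add_le_add ha hb).trans h

theorem mem_withDegree_Iic {k l : ℤ} {p : WeylAlgebra R σ} (hp : p ∈ withDegree w {k})
    (h : k ≤ l) : p ∈ withDegree w (Set.Iic l) :=
  withDegree_mono (by simpa using h) hp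

/-- An algebra endomorphism that changes each letter only by terms of lower degree does the same to
every homogeneous operator. -/
theorem map_sub_mem_withDegree (f : WeylAlgebra R σ →ₐ[R] WeylAlgebra R σ)
    (hx : ∀ i, f (x R i) - x R i ∈ withDegree w (Set.Iic (-w i - 1)))
    (hd : ∀ i, f (d R i) - d R i ∈ withDegree w (Set.Iic (w i - 1)))
    {k : ℤ} {p : WeylAlgebra R σ} (hp : p ∈ withDegree w (Set.Iic k)) :
    f p - p ∈ withDegree w (Set.Iic (k - 1)) := by
  have step : ∀ {g q : WeylAlgebra R σ} {a b c : ℤ}, g ∈ withDegree w {a} →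
      q ∈ withDegree w {b} → f g - g ∈ withDegree w (Set.Iic (a - 1)) →
      f q - q ∈ withDegree w (Set.Iic (b - 1)) → a + b = c →
      f (g * q) - g * q ∈ withDegree w (Set.Iic (c - 1)) := by
    intro g q a b c hg hq hfg hfq habc
    have e : f (g * q) - g * q = (f g - g) * (f q - q) + (f g - g) * q + g * (f q - q) := by
      rw [map_mul, sub_mul, mul_sub, mul_sub, sub_mul]
      abel
    rw [e]
    refine add_mem (add_mem ?_ ?_) ?_
    · exact mul_mem_withDegree_Iic hfg hfq (by omega)
    · exact mul_mem_withDegree_Iic hfg (mem_withDegree_Iic hq le_rfl) (by omega)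
    · exact mul_mem_withDegree_Iic (mem_withDegree_Iic hg le_rfl) hfq (by omega)
  have hα : ∀ α : σ →₀ ℕ, f (xMon R α) - xMon R α ∈
      withDegree w (Set.Iic (wDegree w (α, 0) - 1)) := by
    intro α
    induction α using exponent_induction with
    | h0 => simp
    | hs α i ih =>
      rw [add_comm, xMon_add, xMon_single, pow_one]
      refine step (x_mem_withDegree i) ?_ (hx i) ih
        (by rw [← wDegree_single_left (w := w), ← wDegree_add]; simp)
      simpa using mon_mem_withDegree (R := R) (w := w) (S := {wDegree w (α, 0)}) (α := α)
        (β := 0) rfl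
  have hβ : ∀ β : σ →₀ ℕ, f (dMon R β) - dMon R β ∈
      withDegree w (Set.Iic (wDegree w (0, β) - 1)) := by
    intro β
    induction β using exponent_induction with
    | h0 => simp
    | hs β i ih =>
      rw [add_comm, dMon_add, dMon_single, pow_one]
      refine step (d_mem_withDegree i) ?_ (hd i) ih
        (by rw [← wDegree_single_right (w := w), ← wDegree_add]; simp)
      simpa using mon_mem_withDegree (R := R) (w := w) (S := {wDegree w (0, β)}) (α := 0)
        (β := β) rfl
  induction hp using Submodule.span_induction with
  | zero => simp
  | add p q _ _ hp hq => rw [map_add, add_sub_add_comm]; exact add_mem hp hq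
  | smul c p _ hp => 
    rw [map_smul]
    have h := Submodule.smul_mem _ c hp
    rwa [smul_sub c (f p) p] at h
  | mem p hp =>
    obtain ⟨⟨α, β⟩, h, rfl⟩ := hp
    have h' : wDegree w (α, β) ≤ k := h
    refine withDegree_mono (Set.Iic_subset_Iic.mpr (sub_le_sub_right h' 1))
      (step ?_ ?_ (hα α) (hβ β) (by rw [← wDegree_add]; simp))
    · simpa using mon_mem_withDegree (R := R) (w := w) (S := {wDegree w (α, 0)}) (α := α)
        (β := 0) rfl
    · simpa using mon_mem_withDegree (R := R) (w := w) (S := {wDegree w (0, β)}) (α := 0)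
        (β := β) rfl

end Weight

/-! ### Homogeneous components and initial forms -/

section Components

variable {R : Type*} [CommRing R] [IsDomain R] [CharZero R] {σ : Type*} [Fintype σ]
variable {w : σ → ℤ} {S : Set ℤ}

theorem coeffs_symm_apply (f : ((σ →₀ ℕ) × (σ →₀ ℕ)) →₀ R) : coeffs.symm f = ofCoeff R f := rfl

theorem mem_withDegree_iff {p : WeylAlgebra R σ} :
    p ∈ withDegree w S ↔ ∀ m, coeffs p m ≠ 0 → wDegree w m ∈ S := by
  have e : withDegree (R := R) w S
      = (Finsupp.supported R R (wDegree w ⁻¹' S)).map (ofCoeff R (σ := σ)) := by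
    rw [Finsupp.supported_eq_span_single, Submodule.map_span, withDegree, ← Set.image_comp]
    congr 1
    refine Set.image_congr fun m _ => ?_
    simp [ofCoeff_single]
  obtain ⟨f, rfl⟩ := ofCoeff_surjective R p
  rw [e, ← coeffs_symm_apply, LinearEquiv.apply_symm_apply, coeffs_symm_apply, Submodule.mem_map]
  constructor
  · rintro ⟨g, hg, h⟩ m hm
    rw [← ofCoeff_injective R h] at hm
    exact hg (Finsupp.mem_support_iff.mpr hm)
  · intro h
    exact ⟨f, fun m hm => h m (Finsupp.mem_support_iff.mp hm), rfl⟩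

open Classical in
/-- The homogeneous component of `(-w, w)`-degree `k` of an operator. -/
noncomputable def component (w : σ → ℤ) (k : ℤ) : WeylAlgebra R σ →+ WeylAlgebra R σ :=
  (coeffs.symm.toLinearMap.toAddMonoidHom.comp
    (Finsupp.filterAddHom fun m => wDegree w m = k)).comp coeffs.toLinearMap.toAddMonoidHom

open Classical in
theorem coeffs_component (k : ℤ) (p : WeylAlgebra R σ) (m : (σ →₀ ℕ) × (σ →₀ ℕ)) :
    coeffs (component w k p) m = if wDegree w m = k then coeffs p m else 0 := by
  have h : coeffs (component w k p) = (coeffs p).filter (fun m => wDegree w m = k) :=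
    coeffs.apply_symm_apply _
  rw [h, Finsupp.filter_apply]

theorem component_mem (k : ℤ) (p : WeylAlgebra R σ) : component w k p ∈ withDegree w {k} := by
  classical
  rw [mem_withDegree_iff]
  intro m hm
  by_contra h
  exact hm (by rw [coeffs_component]; exact if_neg h)

theorem component_of_mem {k : ℤ} {p : WeylAlgebra R σ} (hp : p ∈ withDegree w {k}) :
    component w k p = p := by
  classical
  refine coeffs.injective (Finsupp.ext fun m => ?_)
  rw [coeffs_component, ite_eq_left_iff]
  intro h
  by_contra h0
  exact h (mem_withDegree_iff.mp hp m (Ne.symm h0))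

theorem component_of_mem_of_notMem {k : ℤ} {p : WeylAlgebra R σ} (hp : p ∈ withDegree w S)
    (hk : k ∉ S) : component w k p = 0 := by
  classical
  refine coeffs.injective (Finsupp.ext fun m => ?_)
  rw [coeffs_component, map_zero, Finsupp.zero_apply, ite_eq_right_iff]
  rintro rfl
  by_contra h0
  exact hk (mem_withDegree_iff.mp hp m h0)

theorem component_mul {k : ℤ} (p : WeylAlgebra R σ) {q : WeylAlgebra R σ}
    (hq : q ∈ withDegree w {0}) : component w k (p * q) = component w k p * q := by
  have hp : p ∈ withDegree (R := R) w Set.univ := by rw [withDegree_univ]; trivial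
  induction hp using Submodule.span_induction with
  | zero => simp
  | add p p' _ _ h h' => rw [add_mul, map_add, map_add, add_mul, h, h']
  | smul c p _ h =>
    have hc : ∀ u : WeylAlgebra R σ, component w k (c • u) = c • component w k u := by
      classical
      intro u
      refine coeffs.injective (Finsupp.ext fun m => ?_)
      rw [coeffs_component, map_smul, map_smul, Finsupp.smul_apply, Finsupp.smul_apply,
        coeffs_component, smul_ite, smul_zero]
    rw [smul_mul_assoc, hc, hc, h, smul_mul_assoc]
  | mem p hp =>
    obtain ⟨m, -, rfl⟩ := hp
    have hm : xMon R m.1 * dMon R m.2 ∈ withDegree (R := R) w {wDegree w m} :=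
      mon_mem_withDegree rfl
    have hmq := mul_mem_withDegree_singleton hm hq (add_zero _)
    by_cases h : k = wDegree w m
    · rw [h, component_of_mem hm, component_of_mem hmq]
    · rw [component_of_mem_of_notMem hm h, component_of_mem_of_notMem hmq h, zero_mul]

/-- A left ideal with generators of degree `0` contains the homogeneous components of its
elements. -/
theorem component_mem_span {G : Set (WeylAlgebra R σ)} (hG : ∀ g ∈ G, g ∈ withDegree w {0})
    (k : ℤ) {p : WeylAlgebra R σ} (hp : p ∈ Ideal.span G) : component w k p ∈ Ideal.span G := by
  induction hp using Submodule.span_induction with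
  | zero => simp
  | add p q _ _ hp hq => rw [map_add]; exact add_mem hp hq
  | mem g hg =>
    have := component_mul (k := k) 1 (hG g hg)
    rw [one_mul] at this
    rw [this]
    exact Ideal.mul_mem_left _ _ (Ideal.subset_span hg)
  | smul a p hp' hp =>
    suffices h : ∀ a, component w k (a * p) ∈ Ideal.span G from h a
    clear hp a
    induction hp' using Submodule.span_induction with
    | zero => simp
    | add p q _ _ hp hq => intro a; rw [mul_add, map_add]; exact add_mem (hp a) (hq a)
    | mem g hg =>
      intro a
      rw [component_mul a (hG g hg)]
      exact Ideal.mul_mem_left _ _ (Ideal.subset_span hg)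
    | smul b p _ hp => intro a; rw [smul_eq_mul, ← mul_assoc]; exact hp _

/-- The initial form is determined by the nonzero homogeneous part of highest degree. -/
theorem initialForm_eq {k : ℤ} {p u : WeylAlgebra R σ} (hu : u ∈ withDegree w {k}) (hu0 : u ≠ 0)
    (hp : p - u ∈ withDegree w (Set.Iic (k - 1))) : initialForm w p = u := by
  classical
  obtain ⟨v, rfl⟩ : ∃ v, p = u + v := ⟨p - u, by abel⟩
  rw [add_sub_cancel_left, mem_withDegree_iff] at hp
  rw [mem_withDegree_iff] at hu
  have hv0 : ∀ m, wDegree w m = k → coeffs v m = 0 := by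
    intro m hm
    by_contra h
    have := hp m h
    rw [Set.mem_Iic] at this
    omega
  obtain ⟨m₀, hm₀⟩ : ∃ m, coeffs u m ≠ 0 := by
    by_contra! h
    exact hu0 (coeffs.injective (Finsupp.ext fun m => by simp [h]))
  have hk₀ : wDegree w m₀ = k := hu m₀ hm₀
  have hle : ∀ m, coeffs (u + v) m ≠ 0 → wDegree w m ≤ k := by
    intro m hm
    by_contra! h
    have h1 : coeffs u m = 0 := by
      by_contra h1
      exact h.ne' (hu m h1)
    have h2 : coeffs v m = 0 := by
      by_contra h2
      have := hp m h2
      rw [Set.mem_Iic] at this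
      omega
    exact hm (by simp [h1, h2])
  rw [initialForm, LinearEquiv.symm_apply_eq]
  ext m
  rw [Finsupp.filter_apply]
  have hsum : coeffs (u + v) m = coeffs u m + coeffs v m := by simp
  by_cases hm : wDegree w m = k
  · rw [if_pos, hsum, hv0 m hm, add_zero]
    intro m' hm'
    rw [hm]
    exact hle m' (Finsupp.mem_support_iff.mp hm')
  · have h1 : coeffs u m = 0 := by
      by_contra h1
      exact hm (hu m h1)
    rw [h1, ite_eq_right_iff]
    intro h
    by_contra hc
    have hmem : m₀ ∈ (coeffs (u + v)).support := by
      rw [Finsupp.mem_support_iff, map_add, Finsupp.add_apply, hv0 m₀ hk₀, add_zero]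
      exact hm₀
    exact hm (le_antisymm (hle m hc) (hk₀ ▸ h m₀ hmem))

end Components
end WeylAlgebra

/-! ### Canonical commutation relations -/

namespace WeylAlgebra

section Lift

attribute [local instance] LieRing.ofAssociativeRing

variable {R : Type*} [CommRing R] {σ : Type*}

theorem lie_x_x (i j : σ) : ⁅x R i, x R j⁆ = 0 := (x_comm R i j).lie_eq

theorem lie_d_d (i j : σ) : ⁅d R i, d R j⁆ = 0 := (d_comm R i j).lie_eq

theorem lie_d_x [DecidableEq σ] (i j : σ) : ⁅d R i, x R j⁆ = if i = j then 1 else 0 := by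
  rw [Ring.lie_def]
  split_ifs with h
  · subst h
    rw [d_mul_x_self, add_sub_cancel_left]
  · rw [d_mul_x_of_ne R h, sub_self]

/-- The universal property of the Weyl algebra: letters satisfying the canonical commutation
relations extend to an algebra homomorphism. -/
noncomputable def lift [DecidableEq σ] {A : Type*} [Ring A] [Algebra R A] (X P : σ → A)
    (hX : ∀ i j, ⁅X i, X j⁆ = 0) (hP : ∀ i j, ⁅P i, P j⁆ = 0)
    (hPX : ∀ i j, ⁅P i, X j⁆ = if i = j then 1 else 0) : WeylAlgebra R σ →ₐ[R] A :=
  RingQuot.liftAlgHom R ⟨FreeAlgebra.lift R (Sum.elim X P), by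
    intro p q h
    cases h with
    | xx i j => simpa [Ring.lie_def, sub_eq_zero] using hX i j
    | dd i j => simpa [Ring.lie_def, sub_eq_zero] using hP i j
    | dx_ne i j h => simpa [Ring.lie_def, sub_eq_zero, h] using hPX i j
    | dx_self i => simpa [Ring.lie_def, sub_eq_iff_eq_add, add_comm] using hPX i i⟩

section

variable [DecidableEq σ] {A : Type*} [Ring A] [Algebra R A] (X P : σ → A)
    (hX : ∀ i j, ⁅X i, X j⁆ = 0) (hP : ∀ i j, ⁅P i, P j⁆ = 0)
    (hPX : ∀ i j, ⁅P i, X j⁆ = if i = j then 1 else 0)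

@[simp] theorem lift_x (i : σ) : lift (R := R) X P hX hP hPX (x R i) = X i := by
  simp [lift, x]

@[simp] theorem lift_d (i : σ) : lift (R := R) X P hX hP hPX (d R i) = P i := by
  simp [lift, d]

end

theorem algHom_ext {A : Type*} [Ring A] [Algebra R A] {f g : WeylAlgebra R σ →ₐ[R] A}
    (hx : ∀ i, f (x R i) = g (x R i)) (hd : ∀ i, f (d R i) = g (d R i)) : f = g := by
  apply RingQuot.ringQuot_ext'
  apply FreeAlgebra.hom_ext
  funext s
  cases s with
  | inl i => exact hx i
  | inr i => exact hd i

theorem lie_mul_right {A : Type*} [Ring A] (a b c : A) : ⁅a, b * c⁆ = ⁅a, b⁆ * c + b * ⁅a, c⁆ := by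
  simp only [Ring.lie_def]
  noncomm_ring

theorem lie_mul_left {A : Type*} [Ring A] (a b c : A) : ⁅a * b, c⁆ = a * ⁅b, c⁆ + ⁅a, c⁆ * b := by
  simp only [Ring.lie_def]
  noncomm_ring

end Lift

end WeylAlgebra

/-! ### The automorphism `exp (t ad G)` -/

namespace FisherBingham

section Shear

attribute [local instance] LieRing.ofAssociativeRing

open WeylAlgebra

variable {n : ℕ}

theorem const_lie (t : ℂ) (a : D n) : ⁅(const t : D n), a⁆ = 0 :=
  Commute.lie_eq (Algebra.commutes t a)

theorem lie_const_mul (t : ℂ) (a b : D n) : ⁅a, const t * b⁆ = const t * ⁅a, b⁆ := by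
  rw [lie_mul_right, ← lie_skew, const_lie, neg_zero, zero_mul, zero_add]

theorem const_mul_lie (t : ℂ) (a b : D n) : ⁅const t * a, b⁆ = const t * ⁅a, b⁆ := by
  rw [lie_mul_left, const_lie, zero_mul, add_zero]

/-- `x_ij` for `i ≠ j`, and `0` for `i = j`. -/
noncomputable def xOff (i j : Fin (n + 1)) : D n := if i = j then 0 else x i j

/-- `∂_i ∂_j` for `i ≠ j`, and `0` for `i = j`, as a function of the unordered pair. -/
noncomputable def dyMul : Sym2 (Fin (n + 1)) → D n :=
  Sym2.lift ⟨fun i j => if i = j then 0 else dy i * dy j, fun i j => by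
    by_cases h : i = j
    · simp [h]
    · simp only [if_neg h, if_neg (Ne.symm h)]
      exact d_comm ℂ _ _⟩

theorem dyMul_mk (i j : Fin (n + 1)) :
    dyMul s(i, j) = if i = j then 0 else (dy i * dy j : D n) := rfl

/-- The images of the variables under `exp (t ad G)`, where `G = ∑ i < j, x_ij ∂_i ∂_j`. -/
noncomputable def shearX (t : ℂ) : FBVar n → D n
  | Sum.inl p => WeylAlgebra.x ℂ (Sum.inl p)
  | Sum.inr (Sum.inl k) => y k + const t * ∑ s, xOff k s * dy s
  | Sum.inr (Sum.inr u) => WeylAlgebra.x ℂ (Sum.inr (Sum.inr u))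

/-- The images of the derivations under `exp (t ad G)`, where `G = ∑ i < j, x_ij ∂_i ∂_j`. -/
noncomputable def shearD (t : ℂ) : FBVar n → D n
  | Sum.inl p => WeylAlgebra.d ℂ (Sum.inl p) - const t * dyMul p
  | Sum.inr v => WeylAlgebra.d ℂ (Sum.inr v)

theorem lie_dy_xOff (k i j : Fin (n + 1)) : ⁅(dy k : D n), xOff i j⁆ = 0 := by
  unfold xOff dy x
  split_ifs
  · simp
  · simp [lie_d_x]

theorem lie_xOff_x (i j : Fin (n + 1)) (v : FBVar n) : ⁅xOff i j, WeylAlgebra.x ℂ v⁆ = 0 := by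
  unfold xOff x
  split_ifs
  · simp
  · exact lie_x_x _ _

theorem lie_xOff_xOff (i j k l : Fin (n + 1)) : ⁅(xOff i j : D n), xOff k l⁆ = 0 := by
  rw [xOff.eq_1 k l]
  split_ifs
  · simp
  · exact lie_xOff_x _ _ _

theorem xOff_comm (i j : Fin (n + 1)) : (xOff i j : D n) = xOff j i := by
  unfold xOff x
  rw [Sym2.eq_swap]
  simp only [eq_comm]

theorem lie_dy_y (i j : Fin (n + 1)) : ⁅(dy i : D n), y j⁆ = if i = j then 1 else 0 := by
  simp [dy, y, lie_d_x]

theorem lie_dy_dy (i j : Fin (n + 1)) : ⁅(dy i : D n), dy j⁆ = 0 := lie_d_d _ _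

theorem lie_y_y (i j : Fin (n + 1)) : ⁅(y i : D n), y j⁆ = 0 := lie_x_x _ _

theorem lie_dx_dy (p : Sym2 (Fin (n + 1))) (k : Fin (n + 1)) :
    ⁅(WeylAlgebra.d ℂ (Sum.inl p) : D n), dy k⁆ = 0 := lie_d_d _ _

theorem lie_dx_xOff (i j k l : Fin (n + 1)) :
    ⁅(dx i j : D n), xOff k l⁆ = if k ≠ l ∧ s(i, j) = s(k, l) then 1 else 0 := by
  unfold xOff x dx
  by_cases h : k = l
  · simp [h]
  · simp [h, lie_d_x]

theorem lie_dyMul_of_comm {a : D n} (h : ∀ k, ⁅(dy k : D n), a⁆ = 0) (p : Sym2 (Fin (n + 1))) :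
    ⁅dyMul p, a⁆ = 0 := by
  induction p with
  | _ i j =>
    rw [dyMul_mk]
    split_ifs
    · simp
    · rw [lie_mul_left, h, h]; simp

/-- The cross terms are `t x_ij` and `-t x_ji`, which cancel by the symmetry of `x`. -/
theorem lie_shearX_y (t : ℂ) (i j : Fin (n + 1)) :
    ⁅y i + const t * ∑ s, xOff i s * dy s, (y j + const t * ∑ s, xOff j s * dy s : D n)⁆ = 0 := by
  have h0 : ∀ k l : Fin (n + 1), ⁅∑ s, xOff k s * dy s, (y l : D n)⁆ = xOff k l := by
    intro k l
    have h : ∀ s, ⁅(xOff k s : D n), (y l : D n)⁆ = 0 := fun s => lie_xOff_x _ _ _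
    simp only [sum_lie, lie_mul_left, lie_dy_y, h]
    simp
  have h1 : ⁅∑ s, xOff i s * dy s, (∑ s, xOff j s * dy s : D n)⁆ = 0 := by
    have h : ∀ a b c, ⁅(xOff a b : D n), dy c⁆ = 0 := fun a b (c : Fin (n + 1)) => by
      rw [← lie_skew, lie_dy_xOff, neg_zero]
    simp only [sum_lie, lie_sum, lie_mul_left, lie_mul_right, lie_dy_xOff, lie_dy_dy,
      lie_xOff_xOff, h]
    simp
  rw [add_lie, lie_add, lie_add, lie_y_y, const_mul_lie, const_mul_lie, lie_const_mul, lie_const_mul, h1, h0,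
    ← lie_skew, h0, xOff_comm, mul_zero, mul_zero, add_zero, zero_add, ← mul_add, neg_add_cancel,
    mul_zero]

/-- The contributions `∑ s, [∂_p, x_ks] ∂_s` and `[∂_i ∂_j, y_k]`, `p = ij`, cancel: both are `∂_j`
for `k = i`, `∂_i` for `k = j`, and `0` otherwise. -/
theorem lie_shearD_y (t : ℂ) (p : Sym2 (Fin (n + 1))) (k : Fin (n + 1)) :
    ⁅WeylAlgebra.d ℂ (Sum.inl p) - const t * dyMul p, (y k + const t * ∑ s, xOff k s * dy s : D n)⁆ = 0 := by
  have h0 : ⁅dyMul p, (∑ s, xOff k s * dy s : D n)⁆ = 0 := by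
    refine lie_dyMul_of_comm (fun l => ?_) p
    simp only [lie_sum, lie_mul_right, lie_dy_xOff, lie_dy_dy]
    simp
  have h1 : ⁅(WeylAlgebra.d ℂ (Sum.inl p) : D n), y k⁆ = 0 := by
    simp [y, lie_d_x]
  have h2 : ⁅(WeylAlgebra.d ℂ (Sum.inl p) : D n), ∑ s, xOff k s * dy s⁆ = ⁅dyMul p, y k⁆ := by
    induction p with
    | _ i j =>
      simp only [lie_sum, lie_mul_right, lie_dx_dy, mul_zero, add_zero]
      simp only [← dx.eq_1, lie_dx_xOff, dyMul_mk]
      by_cases hij : i = j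
      · subst hij
        rw [if_pos rfl, zero_lie]
        refine Finset.sum_eq_zero fun s _ => ?_
        rw [if_neg, zero_mul]
        rintro ⟨h, h'⟩
        rw [Sym2.eq_iff] at h'
        omega
      · rw [if_neg hij, lie_mul_left, lie_dy_y, lie_dy_y]
        by_cases hi : i = k
        · subst hi
          rw [Finset.sum_eq_single j]
          · simp [hij, Ne.symm hij]
          · intro s _ hs
            rw [if_neg, zero_mul]
            rintro ⟨h, h'⟩
            rw [Sym2.eq_iff] at h'
            omega
          · simp
        · by_cases hj : j = k
          · subst hj
            rw [Finset.sum_eq_single i]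
            · simp [hi, Ne.symm hi, Sym2.eq_swap]
            · intro s _ hs
              rw [if_neg, zero_mul]
              rintro ⟨h, h'⟩
              rw [Sym2.eq_iff] at h'
              omega
            · simp
          · rw [if_neg hi, if_neg hj]
            simp only [mul_zero, zero_mul, add_zero]
            refine Finset.sum_eq_zero fun s _ => ?_
            rw [if_neg, zero_mul]
            rintro ⟨h, h'⟩
            rw [Sym2.eq_iff] at h'
            omega
  rw [sub_lie, lie_add, lie_add, h1, const_mul_lie, const_mul_lie, lie_const_mul, lie_const_mul, h0, h2]
  simp

theorem lie_shearX_shearX (t : ℂ) (u v : FBVar n) : ⁅shearX t u, shearX t v⁆ = 0 := by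
  have h : ∀ (k : Fin (n + 1)) (v : FBVar n) (_ : ∀ l, v ≠ Sum.inr (Sum.inl l)),
      ⁅(y k + const t * ∑ s, xOff k s * dy s : D n), WeylAlgebra.x ℂ v⁆ = 0 := by
    intro k v hv
    have h1 : ∀ s, ⁅(dy s : D n), WeylAlgebra.x ℂ v⁆ = 0 := fun s => by
      rw [dy, lie_d_x, if_neg (Ne.symm (hv s))]
    simp only [add_lie, const_lie, sum_lie, lie_mul_left, lie_xOff_x, h1, y, lie_x_x]
    simp
  rcases u with p | k | u <;> rcases v with q | l | v <;> simp only [shearX]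
  · exact lie_x_x _ _
  · rw [← lie_skew, h _ _ (by simp), neg_zero]
  · exact lie_x_x _ _
  · exact h _ _ (by simp)
  · exact lie_shearX_y t k l
  · exact h _ _ (by simp)
  · exact lie_x_x _ _
  · rw [← lie_skew, h _ _ (by simp), neg_zero]
  · exact lie_x_x _ _

theorem lie_shearD_shearD (t : ℂ) (u v : FBVar n) : ⁅shearD t u, shearD t v⁆ = 0 := by
  have h : ∀ (p) (v : FBVar n), ⁅(dyMul p : D n), WeylAlgebra.d ℂ v⁆ = 0 := fun p v =>
    lie_dyMul_of_comm (fun _ => lie_d_d _ _) p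
  have h1 : ∀ (p) (v : FBVar n), ⁅WeylAlgebra.d ℂ v, (dyMul p : D n)⁆ = 0 := fun p v => by
    rw [← lie_skew, h, neg_zero]
  have h2 : ∀ p q, ⁅(dyMul p : D n), (dyMul q : D n)⁆ = 0 := fun p q =>
    lie_dyMul_of_comm (fun _ => h1 _ _) p
  rcases u with p | u <;> rcases v with q | v <;>
    simp only [shearD, sub_lie, lie_sub, const_mul_lie, lie_const_mul, h, h1, h2, lie_d_d, mul_zero,
      sub_zero]

theorem lie_shearD_shearX (t : ℂ) (u v : FBVar n) :
    ⁅shearD t u, shearX t v⁆ = if u = v then 1 else 0 := by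
  have h : ∀ (p) (v : FBVar n) (_ : ∀ l, v ≠ Sum.inr (Sum.inl l)),
      ⁅(dyMul p : D n), WeylAlgebra.x ℂ v⁆ = 0 := fun p v hv =>
    lie_dyMul_of_comm (fun s => by rw [dy, lie_d_x, if_neg (Ne.symm (hv s))]) p
  have h1 : ∀ (u : Fin (n + 1) ⊕ Unit) (k : Fin (n + 1)),
      ⁅(WeylAlgebra.d ℂ (Sum.inr u) : D n), ∑ s, xOff k s * dy s⁆ = 0 := by
    intro u k
    have hx : ∀ i j : Fin (n + 1), ⁅(WeylAlgebra.d ℂ (Sum.inr u) : D n), (xOff i j : D n)⁆ = 0 := by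
      intro i j
      unfold xOff x
      split_ifs
      · simp
      · simp [lie_d_x]
    simp only [lie_sum, lie_mul_right, hx, dy, lie_d_d]
    simp
  rcases u with p | u <;> rcases v with q | l | v <;> simp only [shearD, shearX]
  · rw [sub_lie, const_mul_lie, h _ _ (by simp), lie_d_x]; simp
  · rw [lie_shearD_y]; simp
  · rw [sub_lie, const_mul_lie, h _ _ (by simp), lie_d_x]; simp
  · exact lie_d_x _ _
  · rw [lie_add, lie_const_mul, h1, y, lie_d_x]; simp
  · exact lie_d_x _ _

/-- The algebra endomorphism `exp (t ad G)` of `D`, where `G = ∑ i < j, x_ij ∂_i ∂_j`. It fixes the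
`x_ij`, `r`, `∂_ii`, `∂_k`, `∂_r`, and maps `y_k` to `y_k + t ∑ s ≠ k, x_ks ∂_s` and `∂_ij` to
`∂_ij - t ∂_i ∂_j` for `i ≠ j`. -/
noncomputable def shear (t : ℂ) : D n →ₐ[ℂ] D n :=
  WeylAlgebra.lift (shearX t) (shearD t) (lie_shearX_shearX t) (lie_shearD_shearD t)
    (lie_shearD_shearX t)

@[simp] theorem shear_x (t : ℂ) (i j : Fin (n + 1)) : shear t (x i j) = x i j :=
  lift_x ..

@[simp] theorem shear_y (t : ℂ) (k : Fin (n + 1)) :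
    shear t (y k) = y k + const t * ∑ s, xOff k s * dy s :=
  lift_x ..

@[simp] theorem shear_r (t : ℂ) : shear t (r : D n) = r :=
  lift_x ..

@[simp] theorem shear_dx (t : ℂ) (i j : Fin (n + 1)) :
    shear t (dx i j) = dx i j - const t * dyMul s(i, j) :=
  lift_d ..

@[simp] theorem shear_dy (t : ℂ) (k : Fin (n + 1)) : shear t (dy k) = dy k :=
  lift_d ..

@[simp] theorem shear_dr (t : ℂ) : shear t (dr : D n) = dr :=
  lift_d ..

@[simp] theorem shear_const (t z : ℂ) : shear t (const z : D n) = const z :=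
  (shear t).commutes z

@[simp] theorem shear_xOff (t : ℂ) (i j : Fin (n + 1)) : shear t (xOff i j) = xOff i j := by
  unfold xOff
  split_ifs <;> simp

@[simp] theorem shear_dyMul (t : ℂ) (p : Sym2 (Fin (n + 1))) :
    shear t (dyMul p) = dyMul p := by
  induction p with
  | _ i j =>
    rw [dyMul_mk]
    split_ifs <;> simp

theorem shear_comp_shear_neg (t : ℂ) : (shear t).comp (shear (n := n) (-t)) = AlgHom.id ℂ _ := by
  have hc : (const (-t) : D n) = -const t := map_neg _ _
  refine algHom_ext (fun v => ?_) (fun v => ?_)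
  · rcases v with p | k | u
    · induction p with
      | _ i j => simp [← x.eq_1]
    · simp only [← y.eq_1, AlgHom.comp_apply, shear_y, hc, map_add, map_mul, map_neg, map_sum,
        shear_const, shear_xOff, shear_dy, AlgHom.id_apply]
      rw [add_assoc, ← add_mul, add_neg_cancel, zero_mul, add_zero]
    · change shear t (shear (-t) r) = r
      simp
  · rcases v with p | k | u
    · induction p with
      | _ i j =>
        simp only [← dx.eq_1, AlgHom.comp_apply, shear_dx, hc, map_sub, map_mul, map_neg,
          shear_const, shear_dyMul, AlgHom.id_apply]
        rw [sub_sub, ← add_mul, add_neg_cancel, zero_mul, sub_zero]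
    · simp [← dy.eq_1]
    · change shear t (shear (-t) dr) = dr
      simp

theorem shear_surjective (t : ℂ) : Function.Surjective (shear (n := n) t) := fun p =>
  ⟨shear (-t) p, DFunLike.congr_fun (shear_comp_shear_neg t) p⟩

end Shear

end FisherBingham

/-! ### Initial ideals under perturbation of the letters -/

namespace WeylAlgebra

section

variable {R : Type*} [CommRing R] [IsDomain R] [CharZero R] {σ : Type*} [Fintype σ]
variable {w : σ → ℤ}

/-- If `J` has generators of degree `0` and `f` is a surjective endomorphism that changes each
letter only by terms of lower degree, then the initial ideal of `f J` is `J`: the initial form of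
`f p` is the top homogeneous component of `p`, which lies in `J` along with `p`. -/
theorem initialIdeal_map_span (f : WeylAlgebra R σ →ₐ[R] WeylAlgebra R σ)
    (hf : Function.Surjective f)
    (hx : ∀ i, f (x R i) - x R i ∈ withDegree w (Set.Iic (-w i - 1)))
    (hd : ∀ i, f (d R i) - d R i ∈ withDegree w (Set.Iic (w i - 1)))
    {G : Set (WeylAlgebra R σ)} (hG : ∀ g ∈ G, g ∈ withDegree w {0}) :
    initialIdeal w ((Ideal.span G).map f) = Ideal.span G := by
  classical
  apply le_antisymm
  · refine Ideal.span_le.mpr ?_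
    rintro _ ⟨_, hq, rfl⟩
    obtain ⟨p, hp, rfl⟩ := (Ideal.mem_map_iff_of_surjective f hf).mp hq
    by_cases h0 : p = 0
    · have h : initialForm w (0 : WeylAlgebra R σ) = 0 := by
        rw [initialForm, LinearEquiv.symm_apply_eq, map_zero]
        exact Finsupp.filter_zero _
      rw [h0, map_zero, h]
      exact zero_mem _
    · have hne : ((coeffs p).support.image (wDegree w)).Nonempty := by
        rw [Finset.image_nonempty, Finsupp.support_nonempty_iff]
        simpa using h0
      set k := ((coeffs p).support.image (wDegree w)).max' hne with hk
      obtain ⟨m, hm, hmk⟩ := Finset.mem_image.mp (Finset.max'_mem _ hne)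
      have hle : ∀ m, coeffs p m ≠ 0 → wDegree w m ≤ k := fun m hm =>
        Finset.le_max' _ _ (Finset.mem_image_of_mem _ (Finsupp.mem_support_iff.mpr hm))
      have hu0 : component w k p ≠ 0 := by
        intro h
        have h1 := coeffs_component (w := w) k p m
        rw [h, map_zero, Finsupp.zero_apply, if_pos hmk] at h1
        exact Finsupp.mem_support_iff.mp hm h1.symm
      have hlow : p - component w k p ∈ withDegree w (Set.Iic (k - 1)) := by
        rw [mem_withDegree_iff]
        intro m hm
        rw [map_sub, Finsupp.sub_apply, coeffs_component] at hm
        by_cases h : wDegree w m = k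
        · simp [h] at hm
        · rw [if_neg h, sub_zero] at hm
          exact Int.le_sub_one_of_lt (lt_of_le_of_ne (hle m hm) h)
      have hpk : p ∈ withDegree w (Set.Iic k) := mem_withDegree_iff.mpr hle
      have hfp : f p - component w k p ∈ withDegree w (Set.Iic (k - 1)) := by
        rw [← sub_add_sub_cancel (f p) p]
        exact add_mem (map_sub_mem_withDegree f hx hd hpk) hlow
      rw [initialForm_eq (component_mem k p) hu0 hfp]
      exact component_mem_span hG k hp
  · refine Ideal.span_le.mpr fun g hg => ?_
    by_cases h0 : g = 0
    · rw [h0]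
      exact zero_mem _
    · refine Ideal.subset_span ⟨f g, Ideal.mem_map_of_mem f (Ideal.subset_span hg), ?_⟩
      exact initialForm_eq (hG g hg) h0
        (map_sub_mem_withDegree f hx hd (mem_withDegree_Iic (hG g hg) le_rfl))

end

end WeylAlgebra

/-! ### The diagonal system and its image -/

namespace FisherBingham

open WeylAlgebra

variable {n : ℕ}

theorem x_comm (i j : Fin (n + 1)) : (x i j : D n) = x j i := by
  unfold x
  rw [Sym2.eq_swap]

theorem dy_comm (i j : Fin (n + 1)) : (dy i * dy j : D n) = dy j * dy i := d_comm ℂ _ _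

theorem x_self_mem (i : Fin (n + 1)) : (x i i : D n) ∈ withDegree weight {0} := by
  simpa [weight, x] using x_mem_withDegree (R := ℂ) (w := weight) (Sum.inl s(i, i) : FBVar n)

theorem xOff_mem (i j : Fin (n + 1)) : (xOff i j : D n) ∈ withDegree weight {-1} := by
  unfold xOff
  split_ifs with h
  · simp
  · simpa [weight, h, x] using x_mem_withDegree (R := ℂ) (w := weight) (Sum.inl s(i, j) : FBVar n)

theorem dy_mem (k : Fin (n + 1)) : (dy k : D n) ∈ withDegree weight {0} :=
  d_mem_withDegree (w := weight) (Sum.inr (Sum.inl k) : FBVar n)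

theorem y_mem (k : Fin (n + 1)) : (y k : D n) ∈ withDegree weight {0} := by
  simpa [weight, y] using x_mem_withDegree (R := ℂ) (w := weight) (Sum.inr (Sum.inl k) : FBVar n)

theorem r_mem : (r : D n) ∈ withDegree weight {0} := by
  simpa [weight, r] using x_mem_withDegree (R := ℂ) (w := weight) (Sum.inr (Sum.inr ()) : FBVar n)

theorem dr_mem : (dr : D n) ∈ withDegree weight {0} :=
  d_mem_withDegree (w := weight) (Sum.inr (Sum.inr ()) : FBVar n)

theorem const_mem (z : ℂ) : (const z : D n) ∈ withDegree weight {0} :=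
  algebraMap_mem_withDegree z

theorem mul_mem_zero {p q : D n} (hp : p ∈ withDegree weight {0})
    (hq : q ∈ withDegree weight {0}) : p * q ∈ withDegree weight {0} :=
  mul_mem_withDegree_singleton hp hq (add_zero 0)

theorem x_mul_dx_mem (i j : Fin (n + 1)) : (x i j * dx i j : D n) ∈ withDegree weight {0} :=
  mul_mem_withDegree_singleton (x_mem_withDegree _) (d_mem_withDegree _) (neg_add_cancel _)

theorem yShift_mem (θ : FBConst n → ℂ) (i : Fin (n + 1)) :
    yShift θ i ∈ withDegree weight {0} :=
  add_mem (y_mem i) (const_mem _)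

theorem two_mem : (2 : D n) ∈ withDegree weight {0} := by
  have h : (2 : D n) = const 2 := (map_ofNat _ 2).symm
  rw [h]
  exact const_mem 2

/-- `G` has degree `-1`, so `exp (t ad G)` changes each variable by terms of lower degree. -/
theorem shear_x_sub_mem (t : ℂ) (v : FBVar n) :
    shear t (WeylAlgebra.x ℂ v) - WeylAlgebra.x ℂ v ∈
      withDegree weight (Set.Iic (-weight v - 1)) := by
  rw [shear, lift_x]
  rcases v with p | k | u <;> simp only [shearX]
  · rw [sub_self]; exact zero_mem _
  · rw [← y.eq_1, add_sub_cancel_left]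
    refine mem_withDegree_Iic (k := -1) ?_ (by simp [weight])
    refine mul_mem_withDegree_singleton (const_mem t) ?_ (zero_add _)
    exact sum_mem fun s _ => mul_mem_withDegree_singleton (xOff_mem k s) (dy_mem s) (add_zero _)
  · rw [sub_self]; exact zero_mem _

theorem shear_d_sub_mem (t : ℂ) (v : FBVar n) :
    shear t (WeylAlgebra.d ℂ v) - WeylAlgebra.d ℂ v ∈
      withDegree weight (Set.Iic (weight v - 1)) := by
  rw [shear, lift_d]
  rcases v with p | v <;> simp only [shearD]
  · induction p with
    | _ i j =>
      rw [sub_sub_cancel_left, neg_mem_iff, dyMul_mk]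
      split_ifs with h
      · rw [mul_zero]; exact zero_mem _
      · refine mem_withDegree_Iic (k := 0) ?_ (by simp [weight, h])
        exact mul_mem_zero (const_mem t) (mul_mem_zero (dy_mem i) (dy_mem j))
  · rw [sub_self]; exact zero_mem _

variable (θ : FBConst n → ℂ)

theorem shear_diagA (i : Fin (n + 1)) : shear 1 (diagA θ i) = opA θ i i := by
  simp only [diagA, opA, map_sub, map_mul, shear_x, shear_dx, shear_dy, shear_const,
    dyMul_mk, if_true, mul_zero, sub_zero, sq, mul_assoc]

theorem const_one : (const 1 : D n) = 1 := map_one _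

theorem shear_diagOff {i j : Fin (n + 1)} (h : i ≠ j) : shear 1 (diagOff θ i j) = opA θ i j := by
  simp only [diagOff, opA, map_sub, map_mul, shear_x, shear_dx, shear_const, dyMul_mk, if_neg h,
    const_one, one_mul, mul_sub, mul_assoc]

theorem shear_opB : shear 1 (opB : D n) = opB := by
  simp only [opB, map_sub, map_sum, map_pow, shear_dy, shear_r]

theorem shear_yShift (i : Fin (n + 1)) :
    shear 1 (yShift θ i) = yShift θ i + ∑ s, xOff i s * dy s := by
  simp only [yShift, map_add, shear_y, shear_const, const_one, one_mul]
  abel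

theorem sum_xOff_mul {i j : Fin (n + 1)} (h : i ≠ j) :
    (∑ s, xOff j s * dy s) * dy i
      = (x i j * dy i ^ 2 + ∑ s with s ≠ i ∧ s ≠ j, x s j * dy i * dy s : D n) := by
  have h1 : (x i j * dy i ^ 2 : D n) = ∑ s, if s = i then x i j * dy i ^ 2 else 0 := by simp
  rw [h1, Finset.sum_filter, ← Finset.sum_add_distrib, Finset.sum_mul]
  refine Finset.sum_congr rfl fun s _ => ?_
  by_cases hi : s = i
  · subst hi
    simp [xOff, Ne.symm h, x_comm j, sq, mul_assoc]
  · by_cases hj : s = j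
    · subst hj
      simp [xOff, hi]
    · simp [xOff, hi, hj, Ne.symm hj, x_comm j, mul_assoc, dy_comm i]

theorem shear_diagC {i j : Fin (n + 1)} (h : i ≠ j) : shear 1 (diagC θ i j) = opC θ i j := by
  have h2 : shear 1 (2 : D n) = 2 := map_ofNat _ 2
  have e : (∑ s with s ≠ j ∧ s ≠ i, x s i * dy j * dy s : D n)
      = ∑ s with s ≠ i ∧ s ≠ j, x i s * dy j * dy s := by
    simp only [x_comm _ i, and_comm]
  simp only [diagC, opC, map_sub, map_add, map_mul, shear_yShift, shear_x, shear_dy, h2, add_mul,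
    sum_xOff_mul h, sum_xOff_mul h.symm, e, x_comm j i, Finset.sum_sub_distrib]
  abel

theorem sum_sum_eq_two_nsmul {M ι : Type*} [AddCommMonoid M] [Fintype ι] [LinearOrder ι]
    (g : ι → ι → M) (hg : ∀ i j, g i j = g j i) (h0 : ∀ i, g i i = 0) :
    ∑ i, ∑ j, g i j = 2 • ∑ i, ∑ j with i ≤ j, g i j := by
  have h : ∑ i, ∑ j with i ≤ j, g i j = ∑ i, ∑ j with j ≤ i, g i j := by
    simp only [Finset.sum_filter]
    rw [Finset.sum_comm]
    simp only [hg]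
  rw [two_nsmul]
  nth_rw 2 [h]
  simp only [Finset.sum_filter, ← Finset.sum_add_distrib]
  refine Finset.sum_congr rfl fun i _ => Finset.sum_congr rfl fun j _ => ?_
  rcases lt_trichotomy i j with h | rfl | h
  · simp [h.le, h.not_ge]
  · simp [h0]
  · simp [h.le, h.not_ge]

theorem shear_diagE : shear 1 (diagE θ) = opE θ := by
  have h2 : shear 1 (2 : D n) = 2 := map_ofNat _ 2
  have e1 : (∑ i, (∑ s, xOff i s * dy s) * dy i : D n)
      = 2 * ∑ i, ∑ j with i ≤ j, xOff i j * dy i * dy j := by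
    rw [two_mul, ← two_nsmul, ← sum_sum_eq_two_nsmul (fun i j => (xOff i j * dy i * dy j : D n))
      (fun i j => by rw [xOff_comm, mul_assoc, dy_comm, mul_assoc]) (fun i => by simp [xOff])]
    simp only [Finset.sum_mul, mul_assoc, dy_comm]
  have e2 : (∑ i, ∑ j with i ≤ j, x i j * dy i * dy j : D n)
      = ∑ i, x i i * dy i ^ 2 + ∑ i, ∑ j with i ≤ j, xOff i j * dy i * dy j := by
    simp only [Finset.sum_filter, ← Finset.sum_add_distrib]
    refine Finset.sum_congr rfl fun i _ => ?_
    have h1 : (x i i * dy i ^ 2 : D n) = ∑ s, if s = i then x i i * dy i ^ 2 else 0 := by simp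
    rw [h1, ← Finset.sum_add_distrib]
    refine Finset.sum_congr rfl fun j _ => ?_
    by_cases hj : j = i
    · subst hj
      simp [xOff, sq, mul_assoc]
    · simp [xOff, hj, Ne.symm hj]
  simp only [diagE, opE, map_sub, map_mul, map_sum, map_pow, shear_yShift, shear_x, shear_dy,
    shear_r, shear_dr, shear_const, h2, add_mul, Finset.sum_add_distrib, e1, e2, mul_add]
  abel

theorem opA_comm (p q : Fin (n + 1)) : opA θ p q = opA θ q p := by
  have h : (dx p q : D n) = dx q p := by
    unfold dx
    rw [Sym2.eq_swap]
  unfold opA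
  rw [x_comm p q, h, mul_assoc _ (dy p), dy_comm, mul_assoc, Sym2.eq_swap]

/-- The generators of the transformed diagonal system. -/
def diagGenerators : Set (D n) :=
  {P | ∃ i, P = diagA θ i} ∪ {opB} ∪ {P | ∃ i j, i < j ∧ P = diagC θ i j} ∪ {diagE θ}
    ∪ {P | ∃ i j, i ≠ j ∧ P = diagOff θ i j}

theorem diagGenerators_mem : ∀ P ∈ diagGenerators θ, P ∈ withDegree weight {0} := by
  have hsq : ∀ {p : D n}, p ∈ withDegree weight {0} → p ^ 2 ∈ withDegree weight {0} := fun hp => by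
    rw [sq]
    exact mul_mem_zero hp hp
  rintro P ((((⟨i, rfl⟩ | rfl) | ⟨i, j, -, rfl⟩) | rfl) | ⟨i, j, -, rfl⟩)
  · exact sub_mem (sub_mem (x_mul_dx_mem i i) (mul_mem_zero (x_self_mem i) (hsq (dy_mem i))))
      (const_mem _)
  · exact sub_mem (sum_mem fun i _ => hsq (dy_mem i)) (hsq r_mem)
  · exact sub_mem (add_mem (mul_mem_zero (mul_mem_zero (mul_mem_zero two_mem
      (sub_mem (x_self_mem j) (x_self_mem i))) (dy_mem i)) (dy_mem j))
      (mul_mem_zero (yShift_mem θ j) (dy_mem i))) (mul_mem_zero (yShift_mem θ i) (dy_mem j))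
  · exact sub_mem (sub_mem (sub_mem (sub_mem (mul_mem_zero r_mem dr_mem)
      (mul_mem_zero two_mem (sum_mem fun i _ => mul_mem_zero (x_self_mem i) (hsq (dy_mem i)))))
      (sum_mem fun i _ => mul_mem_zero (yShift_mem θ i) (dy_mem i))) (const_mem _)) (const_mem _)
  · exact sub_mem (x_mul_dx_mem i j) (const_mem _)

/-- The transformed Fisher–Bingham system is the image of the transformed diagonal system under the
automorphism `exp (ad G)`, generator by generator. -/
theorem transformedSystem_eq_map :
    transformedSystem θ = (Ideal.span (diagGenerators θ)).map (shear 1) := by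
  rw [Ideal.map_span, transformedSystem]
  congr 1
  ext P
  constructor
  · rintro (((⟨p, q, -, rfl⟩ | rfl) | ⟨i, j, hij, rfl⟩) | rfl)
    · by_cases hpq : p = q
      · subst hpq
        exact ⟨diagA θ p, .inl (.inl (.inl (.inl ⟨p, rfl⟩))), shear_diagA θ p⟩
      · exact ⟨diagOff θ p q, .inr ⟨p, q, hpq, rfl⟩, shear_diagOff θ hpq⟩
    · exact ⟨opB, .inl (.inl (.inl (.inr rfl))), shear_opB⟩
    · exact ⟨diagC θ i j, .inl (.inl (.inr ⟨i, j, hij, rfl⟩)), shear_diagC θ hij.ne⟩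
    · exact ⟨diagE θ, .inl (.inr rfl), shear_diagE θ⟩
  · rintro ⟨_, (((⟨i, rfl⟩ | rfl) | ⟨i, j, hij, rfl⟩) | rfl) | ⟨i, j, hij, rfl⟩, rfl⟩
    · exact .inl (.inl (.inl ⟨i, i, le_rfl, shear_diagA θ i⟩))
    · exact .inl (.inl (.inr shear_opB))
    · exact .inl (.inr ⟨i, j, hij, shear_diagC θ hij.ne⟩)
    · exact .inr (shear_diagE θ)
    · refine .inl (.inl (.inl ?_))
      rcases hij.lt_or_gt with h | h
      · exact ⟨i, j, h.le, shear_diagOff θ hij⟩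
      · exact ⟨j, i, h.le, (shear_diagOff θ hij).trans (opA_comm θ i j)⟩

end FisherBingham

theorem theorem4 (n : ℕ) :
    ∃ F : MvPolynomial (FBConst n) ℂ, F ≠ 0 ∧
      ∀ θ : FBConst n → ℂ, MvPolynomial.eval θ F ≠ 0 →
        WeylAlgebra.initialIdeal FisherBingham.weight (FisherBingham.transformedSystem θ)
          = FisherBingham.transformedDiagonalSystem θ := by
  -- The equality holds for all values of the constants, so `F = 1` serves.
  refine ⟨1, one_ne_zero, fun θ _ => ?_⟩
  rw [FisherBingham.transformedSystem_eq_map]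
  exact WeylAlgebra.initialIdeal_map_span _ (FisherBingham.shear_surjective 1)
    (FisherBingham.shear_x_sub_mem 1) (FisherBingham.shear_d_sub_mem 1)
    (FisherBingham.diagGenerators_mem θ)
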